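/- Let $\mathbb T=\mathbb R\cup\mathbb R^{\nu}\cup\{-\infty\}$ be the extended tropical semiring: $\mathbb R^\nu=\{a^\nu: a\in\mathbb R\}$ is a second (ghost) copy of the reals, and $\mathbb T$ is totally ordered by $-\infty\prec x$ for all $x\neq-\infty$, by $a\prec b$, $a\prec b^\nu$, $a^\nu\prec b$, $a^\nu\prec b^\nu$ for real $a<b$, and by $a\prec a^\nu$. Addition is $x\oplus y=\max_{\prec}\{x,y\}$ for $x\neq y$, $a\oplus a=a^\nu\oplus a^\nu=a^\nu$, $-\infty\oplus-\infty=-\infty$; multiplication is $a\odot b=a+b$, $a^\nu\odot b=a\odot b^\nu=a^\nu\odot b^\nu=(a+b)^\nu$, $(-\infty)\odot x=x\odot(-\infty)=-\infty$. A finite family of vectors $v_1,\dots,v_k\in\mathbb T^{(n)}$ is tropically dependent if there are $\alpha_1,\dots,\alpha_k\in\mathbb R\cup\{-\infty\}$, not all $-\infty$, such that every entry of $\alpha_1v_1\oplus\cdots\oplus\alpha_kv_k$ lies in $\mathbb R^\nu\cup\{-\infty\}$; otherwise it is tropically independent (so the empty family is independent). The tropical rank of an $m\times n$ matrix $A$ over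 $\mathbb T$ is the maximal number of tropically independent rows of $A$. Then, for every $m\times n$ matrix $A$ over $\mathbb T$, the tropical rank of $A$ equals the maximal number of tropically independent columns of $A$. -/

import Mathlib

noncomputable section

/-- The underlying set `𝕋 = ℝ ∪ ℝ^ν ∪ {-∞}` of the extended tropical semiring: two copies of the
reals (the real part and the ghost part), each enlarged by `-∞`, glued along `-∞`. -/
inductive ExtTrop : Type
  | negInf : ExtTrop
  | real : ℝ → ExtTrop
  | ghost : ℝ → ExtTrop

namespace ExtTrop

/-- The ghost map `ν`: `a ↦ a^ν`, `a^ν ↦ a^ν`, `-∞ ↦ -∞`. -/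
def nu : ExtTrop → ExtTrop
  | negInf => negInf
  | real a => ghost a
  | ghost a => ghost a

/-- The position of an element in the total order: first by its value, then real before ghost. -/
def toLexVal : ExtTrop → WithBot (ℝ ×ₗ Bool)
  | negInf => ⊥
  | real a => ((toLex (a, false) : ℝ ×ₗ Bool) : WithBot (ℝ ×ₗ Bool))
  | ghost a => ((toLex (a, true) : ℝ ×ₗ Bool) : WithBot (ℝ ×ₗ Bool))

theorem toLexVal_injective : Function.Injective toLexVal := by
  intro x y h
  cases x <;> cases y <;> simp_all [toLexVal]

/-- The total order `≺` on `𝕋`; the lemmas below spell it out. -/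
instance : LinearOrder ExtTrop := LinearOrder.lift' toLexVal toLexVal_injective

theorem lt_iff_toLexVal (x y : ExtTrop) : x < y ↔ toLexVal x < toLexVal y := Iff.rfl

@[simp] theorem negInf_lt_real (a : ℝ) : negInf < real a := by
  simp [lt_iff_toLexVal, toLexVal]

@[simp] theorem negInf_lt_ghost (a : ℝ) : negInf < ghost a := by
  simp [lt_iff_toLexVal, toLexVal]

@[simp] theorem real_lt_real (a b : ℝ) : real a < real b ↔ a < b := by
  simp [lt_iff_toLexVal, toLexVal, Prod.Lex.toLex_lt_toLex]

@[simp] theorem ghost_lt_ghost (a b : ℝ) : ghost a < ghost b ↔ a < b := by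
  simp [lt_iff_toLexVal, toLexVal, Prod.Lex.toLex_lt_toLex]

@[simp] theorem real_lt_ghost (a b : ℝ) : real a < ghost b ↔ a ≤ b := by
  simp [lt_iff_toLexVal, toLexVal, Prod.Lex.toLex_lt_toLex, le_iff_lt_or_eq]

@[simp] theorem ghost_lt_real (a b : ℝ) : ghost a < real b ↔ a < b := by
  simp [lt_iff_toLexVal, toLexVal, Prod.Lex.toLex_lt_toLex]

/-- The addition `⊕`: the maximum of two distinct elements, and `x ⊕ x = x^ν`
(in particular `-∞ ⊕ -∞ = -∞`). -/
instance : Add ExtTrop := ⟨fun x y => if x = y then nu x else max x y⟩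

/-- The multiplication `⊙`: addition of values, real only if both factors are real, and
absorbed by `-∞`. -/
instance : Mul ExtTrop := ⟨fun x y =>
  match x, y with
  | negInf, _ => negInf
  | _, negInf => negInf
  | real a, real b => real (a + b)
  | real a, ghost b => ghost (a + b)
  | ghost a, real b => ghost (a + b)
  | ghost a, ghost b => ghost (a + b)⟩

/-- The zero element is `-∞`. -/
instance : Zero ExtTrop := ⟨negInf⟩

/-- The unit element is the real number `0`. -/
instance : One ExtTrop := ⟨real 0⟩

theorem zero_def : (0 : ExtTrop) = negInf := rfl

theorem one_def : (1 : ExtTrop) = real 0 := rfl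

theorem add_def (x y : ExtTrop) : x + y = if x = y then nu x else max x y := rfl

@[simp] theorem negInf_mul (x : ExtTrop) : negInf * x = negInf := by cases x <;> rfl

@[simp] theorem mul_negInf (x : ExtTrop) : x * negInf = negInf := by cases x <;> rfl

@[simp] theorem real_mul_real (a b : ℝ) : real a * real b = real (a + b) := rfl

@[simp] theorem real_mul_ghost (a b : ℝ) : real a * ghost b = ghost (a + b) := rfl

@[simp] theorem ghost_mul_real (a b : ℝ) : ghost a * real b = ghost (a + b) := rfl

@[simp] theorem ghost_mul_ghost (a b : ℝ) : ghost a * ghost b = ghost (a + b) := rfl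

@[simp] theorem negInf_add (x : ExtTrop) : negInf + x = x := by
  cases x <;> simp [add_def, nu, le_of_lt]

@[simp] theorem add_negInf (x : ExtTrop) : x + negInf = x := by
  cases x <;> simp [add_def, nu, le_of_lt]

@[simp] theorem real_add_real (a b : ℝ) :
    real a + real b = if a = b then ghost a else if a < b then real b else real a := by
  simp only [add_def, real.injEq, nu, max_def_lt, real_lt_real]

@[simp] theorem real_add_ghost (a b : ℝ) :
    real a + ghost b = if a ≤ b then ghost b else real a := by
  simp only [add_def, reduceCtorEq, if_false, max_def_lt, real_lt_ghost]

@[simp] theorem ghost_add_real (a b : ℝ) :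
    ghost a + real b = if a < b then real b else ghost a := by
  simp only [add_def, reduceCtorEq, if_false, max_def_lt, ghost_lt_real]

@[simp] theorem ghost_add_ghost (a b : ℝ) :
    ghost a + ghost b = if a < b then ghost b else ghost a := by
  simp only [add_def, ghost.injEq, nu, max_def_lt, ghost_lt_ghost]
  split_ifs <;> simp_all

protected theorem add_comm' (x y : ExtTrop) : x + y = y + x := by
  rw [add_def, add_def, max_comm]
  by_cases h : x = y
  · simp [h]
  · simp [h, Ne.symm h]

protected theorem mul_comm' (x y : ExtTrop) : x * y = y * x := by
  cases x <;> cases y <;> simp [add_comm]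

protected theorem mul_assoc' (x y z : ExtTrop) : x * y * z = x * (y * z) := by
  cases x <;> cases y <;> cases z <;> simp [add_assoc]

protected theorem add_assoc' (x y z : ExtTrop) : x + y + z = x + (y + z) := by
  cases x <;> cases y <;> cases z <;> simp <;> grind [real_add_real, real_add_ghost,
    ghost_add_real, ghost_add_ghost]

protected theorem mul_add' (x y z : ExtTrop) : x * (y + z) = x * y + x * z := by
  cases x <;> cases y <;> cases z <;> simp <;> grind [real_mul_real, real_mul_ghost,
    ghost_mul_real, ghost_mul_ghost]

/-- The extended tropical semiring `(𝕋, ⊕, ⊙)`. -/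
instance : CommSemiring ExtTrop where
  add_assoc := ExtTrop.add_assoc'
  zero_add := negInf_add
  add_zero := add_negInf
  add_comm := ExtTrop.add_comm'
  nsmul := nsmulRec
  mul_assoc := ExtTrop.mul_assoc'
  one_mul x := by cases x <;> simp [one_def]
  mul_one x := by cases x <;> simp [one_def]
  zero_mul := negInf_mul
  mul_zero := mul_negInf
  left_distrib := ExtTrop.mul_add'
  right_distrib x y z := by
    rw [ExtTrop.mul_comm', ExtTrop.mul_add', ExtTrop.mul_comm' z x, ExtTrop.mul_comm' z y]
  mul_comm := ExtTrop.mul_comm'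

/-- `ℝ ∪ {-∞}`, as a subset of `𝕋`. -/
def realPart : Set ExtTrop := {x | x = negInf ∨ ∃ a : ℝ, x = real a}

/-- `ℝ^ν ∪ {-∞}`, as a subset of `𝕋`. -/
def ghostPart : Set ExtTrop := {x | x = negInf ∨ ∃ a : ℝ, x = ghost a}

/-- A vector of `𝕋^(n)` is a ghost vector if all its entries are ghosts or `-∞`. -/
def IsGhostVector {n : ℕ} (v : Fin n → ExtTrop) : Prop := ∀ j, v j ∈ ghostPart

/-- A finite collection of vectors is tropically dependent if some combination of them, with
coefficients in `ℝ ∪ {-∞}` not all equal to `-∞`, is a ghost vector. -/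
def TropDependent {ι : Type*} [Fintype ι] {n : ℕ} (v : ι → Fin n → ExtTrop) : Prop :=
  ∃ α : ι → ExtTrop, (∀ i, α i ∈ realPart) ∧ (∃ i, α i ≠ negInf) ∧
    IsGhostVector (∑ i, α i • v i)

/-- Tropically independent means not tropically dependent. -/
def TropIndependent {ι : Type*} [Fintype ι] {n : ℕ} (v : ι → Fin n → ExtTrop) : Prop :=
  ¬ TropDependent v

open scoped Classical in
/-- The tropical rank of a matrix: the maximal number of tropically independent rows. -/
def tropRank {m n : ℕ} (A : Matrix (Fin m) (Fin n) ExtTrop) : ℕ :=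
  (Finset.univ.filter fun s : Finset (Fin m) =>
    TropIndependent fun i : s => A.row i).sup Finset.card

/-- The tropical rank is the greatest size of a tropically independent set of rows. -/
theorem isGreatest_tropRank {m n : ℕ} (A : Matrix (Fin m) (Fin n) ExtTrop) :
    IsGreatest {k : ℕ | ∃ s : Finset (Fin m), s.card = k ∧
      TropIndependent fun i : s => A.row i} (tropRank A) := by
  classical
  constructor
  · have hne : (Finset.univ.filter fun s : Finset (Fin m) =>
        TropIndependent fun i : s => A.row i).Nonempty := by
      refine ⟨∅, ?_⟩
      simp only [Finset.mem_filter, Finset.mem_univ, true_and]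
      rintro ⟨α, -, ⟨i, -⟩, -⟩
      exact absurd i.2 (Finset.notMem_empty _)
    obtain ⟨s, hs, h⟩ := Finset.exists_mem_eq_sup _ hne Finset.card
    refine ⟨s, ?_, (Finset.mem_filter.mp hs).2⟩
    rw [tropRank, ← h]
  · rintro k ⟨s, rfl, hs⟩
    exact Finset.le_sup (f := Finset.card) (by simpa using hs)

end ExtTrop

end

/-! ### Min-max operators on the nonnegative orthant -/

open Filter Topology

/-! Passing to the transpose, it suffices to turn independent rows into equally many independent
columns. Write `|A l j|` for the exponential of the value and set `F(x)_i = min_j max_{l ≠ i} |A l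
j| x_l / |A i j|`, with `j` running over the columns where row `i` is real. A nonzero `x ≤ F(x)`
gives dependence of the rows: with coefficients `log x_l`, no column has its maximum attained only
once and at a real term. Otherwise some positive `b` has `F(b) < b`. The minimising columns then
give each row its own column, in which it strictly dominates after scaling by `b`, and such columns
are independent. The dichotomy comes from perturbing `F` to a log-scale contraction: the sign of its
fixed points decides the case, by compactness as the perturbation vanishes. -/

/-- Discounted min-max equations have a solution: `x i = min_{j ∈ J i} max_l (r * x l + c i j l)`. -/
theorem exists_discounted_minmax_solution {ι κ : Type*} [Fintype ι] [Nonempty ι]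
    (J : ι → Finset κ) (hJ : ∀ i, (J i).Nonempty) (c : ι → κ → ι → ℝ) (r : ℝ)
    (hr0 : 0 ≤ r) (hr1 : r < 1) :
    ∃ x : ι → ℝ, (∀ i, ∀ j ∈ J i, ∃ l, x i ≤ r * x l + c i j l) ∧
      ∀ i, ∃ j ∈ J i, ∀ l, r * x l + c i j l ≤ x i := by
  let G : (ι → ℝ) → ι → ℝ := fun x i =>
    (J i).inf' (hJ i) fun j => Finset.univ.sup' Finset.univ_nonempty fun l => r * x l + c i j l
  have key : ∀ x y i, G x i ≤ G y i + r * dist x y := by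
    intro x y i
    obtain ⟨j, hj, hjy⟩ := Finset.exists_mem_eq_inf' (hJ i)
      fun j => Finset.univ.sup' Finset.univ_nonempty fun l => r * y l + c i j l
    refine (Finset.inf'_le _ hj).trans (Finset.sup'_le _ _ fun l _ => ?_)
    have h1 : r * y l + c i j l ≤ G y i := by
      change _ ≤ (J i).inf' _ _
      rw [hjy]
      exact Finset.le_sup' (fun l => r * y l + c i j l) (Finset.mem_univ l)
    have h2 : x l - y l ≤ dist x y :=
      (le_abs_self _).trans ((Real.dist_eq _ _).symm.le.trans (dist_le_pi_dist x y l))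
    nlinarith [mul_le_mul_of_nonneg_left h2 hr0]
  have hG : ContractingWith ⟨r, hr0⟩ G := by
    refine ⟨by exact_mod_cast hr1, LipschitzWith.of_dist_le_mul fun x y => ?_⟩
    refine (dist_pi_le_iff (by positivity)).2 fun i => ?_
    rw [Real.dist_eq, abs_sub_le_iff]
    have h1 := key x y i
    have h2 := key y x i
    rw [dist_comm] at h2
    exact ⟨sub_le_iff_le_add'.2 h1, sub_le_iff_le_add'.2 h2⟩
  obtain ⟨x, hx⟩ : ∃ x, G x = x := ⟨_, hG.fixedPoint_isFixedPt⟩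
  refine ⟨x, fun i j hj => ?_, fun i => ?_⟩
  · obtain ⟨l, -, hl⟩ := Finset.exists_mem_eq_sup' (Finset.univ_nonempty (α := ι))
      fun l => r * x l + c i j l
    refine ⟨l, ?_⟩
    rw [← hl]
    exact (congrFun hx i).symm.le.trans (Finset.inf'_le _ hj)
  · obtain ⟨j, hj, h⟩ := Finset.exists_mem_eq_inf' (hJ i) fun j =>
      Finset.univ.sup' Finset.univ_nonempty fun l => r * x l + c i j l
    refine ⟨j, hj, fun l => ?_⟩
    refine le_trans ?_ (h.symm.le.trans (congrFun hx i).le)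
    exact Finset.le_sup' (fun l => r * x l + c i j l) (Finset.mem_univ l)

/-- A dichotomy for the min-max operator `x ↦ (min_{j ∈ J i} max_l w i j l * x l)_i` on the
nonnegative orthant: there is a nonzero subharmonic vector or a positive strictly superharmonic
one. -/
theorem exists_subharmonic_or_strictly_superharmonic {ι κ : Type*} [Fintype ι]
    [Nonempty ι] (J : ι → Finset κ) (hJ : ∀ i, (J i).Nonempty) (w : ι → κ → ι → ℝ)
    (hw : ∀ i j l, 0 ≤ w i j l) :
    (∃ x : ι → ℝ, (∀ i, 0 ≤ x i) ∧ (∃ i, x i ≠ 0) ∧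
      ∀ i, ∀ j ∈ J i, ∃ l, x i ≤ w i j l * x l) ∨
    ∃ b : ι → ℝ, (∀ i, 0 < b i) ∧ ∀ i, ∃ j ∈ J i, ∀ l, w i j l * b l < b i := by
  -- `e n` is both the discount, which gives a contraction, and a floor for the weights, which keeps
  -- their logarithms meaningful.
  let e : ℕ → ℝ := fun n => 1 / ((n : ℝ) + 1)
  have he0 : ∀ n, 0 < e n := fun n => Nat.one_div_pos_of_nat
  have he1 : ∀ n, e n ≤ 1 := fun n => by
    simp only [e]; rw [div_le_one (by positivity)]; linarith [Nat.cast_nonneg (α := ℝ) n]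
  have het : Tendsto e atTop (𝓝 0) := tendsto_one_div_add_atTop_nhds_zero_nat
  have hpos : ∀ n i j l, 0 < max (w i j l) (e n) := fun n i j l => lt_max_of_lt_right (he0 n)
  choose x hx1 hx2 using fun n => exists_discounted_minmax_solution J hJ
    (fun i j l => Real.log (max (w i j l) (e n))) (1 - e n) (by linarith [he1 n])
    (by linarith [he0 n])
  by_cases hneg : ∃ n, ∀ i, x n i < 0
  · right
    obtain ⟨n, hn⟩ := hneg
    -- For negative `x`, discounting increases it: `x < (1 - e) * x`, which makes the inequality
    -- strict.
    refine ⟨fun i => Real.exp ((1 - e n) * x n i), fun i => Real.exp_pos _, fun i => ?_⟩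
    obtain ⟨j, hj, h⟩ := hx2 n i
    refine ⟨j, hj, fun l => ?_⟩
    calc w i j l * Real.exp ((1 - e n) * x n l)
        ≤ max (w i j l) (e n) * Real.exp ((1 - e n) * x n l) := by gcongr; exact le_max_left _ _
      _ = Real.exp ((1 - e n) * x n l + Real.log (max (w i j l) (e n))) := by
          rw [Real.exp_add, Real.exp_log (hpos n i j l), mul_comm]
      _ ≤ Real.exp (x n i) := Real.exp_le_exp.2 (h l)
      _ < _ := Real.exp_lt_exp.2 (by nlinarith [mul_neg_of_pos_of_neg (he0 n) (hn i)])
  left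
  push Not at hneg
  have hmax : ∀ n, ∃ k, 0 ≤ x n k ∧ ∀ i, x n i ≤ x n k := fun n => by
    obtain ⟨k, hk⟩ := Finite.exists_max (x n)
    obtain ⟨i, hi⟩ := hneg n
    exact ⟨k, hi.trans (hk i), hk⟩
  choose k hk0 hk using hmax
  -- Normalising the largest coordinate to 1 keeps the limit nonzero.
  let z : ℕ → ι → ℝ := fun n i => Real.exp (x n i - x n (k n))
  have hz : ∀ n, z n ∈ Set.univ.pi fun _ : ι => Set.Icc (0 : ℝ) 1 := fun n i _ =>
    ⟨(Real.exp_pos _).le, Real.exp_le_one_iff.2 (by linarith [hk n i])⟩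
  have hzk : ∀ n, z n (k n) = 1 := fun n => by simp [z]
  have hzw : ∀ n i, ∀ j ∈ J i, ∃ l, z n i ≤ max (w i j l) (e n) * z n l ^ (1 - e n) := by
    intro n i j hj
    obtain ⟨l, hl⟩ := hx1 n i j hj
    refine ⟨l, ?_⟩
    simp only [z]
    rw [← Real.exp_mul, ← Real.exp_log (hpos n i j l), ← Real.exp_add]
    refine Real.exp_le_exp.2 ?_
    -- The shift leaves an extra `-e n * x n (k n)`, which is at most 0 since the maximum is
    -- nonnegative.
    nlinarith [mul_nonneg (he0 n).le (hk0 n)]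
  obtain ⟨y, hy, φ, hφ, hlim⟩ := (isCompact_univ_pi fun _ : ι => isCompact_Icc).tendsto_subseq hz
  have hlim' : ∀ i, Tendsto (fun n => z (φ n) i) atTop (𝓝 (y i)) := tendsto_pi_nhds.1 hlim
  have heφ : Tendsto (fun n => e (φ n)) atTop (𝓝 0) := het.comp hφ.tendsto_atTop
  refine ⟨y, fun i => (hy i trivial).1, ?_, fun i j hj => ?_⟩
  · by_contra! h
    have : ∀ᶠ n in atTop, ∀ i, z (φ n) i < 1 :=
      eventually_all.2 fun i => (hlim' i).eventually_lt_const (by rw [h i]; exact one_pos)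
    obtain ⟨n, hn⟩ := this.exists
    exact (hn (k (φ n))).ne (hzk _)
  · by_contra! h
    have : ∀ᶠ n in atTop, ∀ l,
        max (w i j l) (e (φ n)) * z (φ n) l ^ (1 - e (φ n)) < z (φ n) i := by
      refine eventually_all.2 fun l => ?_
      have hy0 : 0 ≤ y l := (hy l trivial).1
      have h1 : Tendsto (fun n => max (w i j l) (e (φ n)) * z (φ n) l ^ (1 - e (φ n))) atTop
          (𝓝 (max (w i j l) 0 * y l ^ (1 - 0 : ℝ))) :=
        (tendsto_const_nhds.max heφ).mul
          ((hlim' l).rpow (tendsto_const_nhds.sub heφ) (Or.inr (by norm_num)))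
      refine h1.eventually_lt (hlim' i) ?_
      rw [sub_zero, Real.rpow_one, max_mul_of_nonneg _ _ hy0, zero_mul]
      exact max_lt (h l) ((mul_nonneg (hw i j l) hy0).trans_lt (h l))
    obtain ⟨n, hn⟩ := this.exists
    obtain ⟨l, hl⟩ := hzw (φ n) i j hj
    exact absurd hl (not_le.2 (hn l))

/-! ### Independence in terms of real inequalities -/

namespace ExtTrop

/-- The exponential of the value of an element of `𝕋`, with `exp (-∞) = 0`. -/
noncomputable def expVal : ExtTrop → ℝ
  | negInf => 0
  | real a => Real.exp a
  | ghost a => Real.exp a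

theorem expVal_nonneg (x : ExtTrop) : 0 ≤ expVal x := by
  cases x <;> simp [expVal, Real.exp_nonneg]

theorem expVal_pos {x : ExtTrop} (hx : x ≠ negInf) : 0 < expVal x := by
  cases x <;> simp_all [expVal, Real.exp_pos]

theorem expVal_mul (x y : ExtTrop) : expVal (x * y) = expVal x * expVal y := by
  cases x <;> cases y <;> simp [expVal, Real.exp_add]

/-- The bound must be real: `real a < ghost a` although their values agree. -/
theorem lt_real_iff_expVal_lt (x : ExtTrop) (a : ℝ) : x < real a ↔ expVal x < expVal (real a) := by
  cases x <;> simp [expVal, Real.exp_pos]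

theorem add_lt_real_iff (x y : ExtTrop) (a : ℝ) : x + y < real a ↔ x < real a ∧ y < real a := by
  cases x <;> cases y <;> simp <;> split_ifs <;> simp <;> grind

theorem add_eq_real_iff (x y : ExtTrop) (a : ℝ) :
    x + y = real a ↔ x = real a ∧ y < real a ∨ y = real a ∧ x < real a := by
  cases x <;> cases y <;> simp <;> grind

theorem sum_lt_real_iff {ι : Type*} (s : Finset ι) (f : ι → ExtTrop) (a : ℝ) :
    ∑ i ∈ s, f i < real a ↔ ∀ i ∈ s, f i < real a := by
  classical
  induction s using Finset.induction_on with
  | empty => simp [zero_def]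
  | insert i s hi ih => rw [Finset.sum_insert hi, add_lt_real_iff, ih]; simp

theorem sum_eq_real_iff {ι : Type*} [DecidableEq ι] (s : Finset ι) (f : ι → ExtTrop) (a : ℝ) :
    ∑ i ∈ s, f i = real a ↔ ∃ i ∈ s, f i = real a ∧ ∀ l ∈ s, l ≠ i → f l < real a := by
  induction s using Finset.induction_on with
  | empty => simp [zero_def]
  | insert i s hi ih =>
    rw [Finset.sum_insert hi, add_eq_real_iff, ih, sum_lt_real_iff]
    constructor
    · rintro (⟨h, hs⟩ | ⟨⟨k, hk, h, hs⟩, hlt⟩)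
      · exact ⟨i, by simp, h, by grind⟩
      · exact ⟨k, by simp [hk], h, by grind⟩
    · rintro ⟨k, hk, h, hs⟩
      rcases Finset.mem_insert.1 hk with rfl | hk
      · exact Or.inl ⟨h, by grind⟩
      · exact Or.inr ⟨⟨k, hk, h, by grind⟩, by grind⟩

theorem notMem_ghostPart_iff (x : ExtTrop) : x ∉ ghostPart ↔ ∃ a, x = real a := by
  cases x <;> simp [ghostPart]

theorem mul_eq_real_iff {x y : ExtTrop} :
    (∃ a, x * y = real a) ↔ (∃ a, x = real a) ∧ ∃ a, y = real a := by
  cases x <;> cases y <;> simp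

/-- A sum is neither a ghost nor `-∞` exactly when its maximum is attained once, at a real
summand. -/
theorem sum_notMem_ghostPart_iff {ι : Type*} [Fintype ι] (f : ι → ExtTrop) :
    ∑ i, f i ∉ ghostPart ↔ ∃ i, (∃ a, f i = real a) ∧ ∀ l, l ≠ i → expVal (f l) < expVal (f i) := by
  classical
  simp only [notMem_ghostPart_iff, sum_eq_real_iff, Finset.mem_univ, true_and, true_implies]
  constructor
  · rintro ⟨a, i, h, hs⟩
    exact ⟨i, ⟨a, h⟩, fun l hl => by rw [h]; exact (lt_real_iff_expVal_lt _ _).1 (hs l hl)⟩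
  · rintro ⟨i, ⟨a, h⟩, hs⟩
    exact ⟨a, i, h, fun l hl => (lt_real_iff_expVal_lt _ _).2 (h ▸ hs l hl)⟩

theorem tropIndependent_iff {ι : Type*} [Fintype ι] {n : ℕ} (v : ι → Fin n → ExtTrop) :
    TropIndependent v ↔ ∀ α : ι → ExtTrop, (∀ i, α i ∈ realPart) → (∃ i, α i ≠ negInf) →
      ∃ j i, (∃ a, α i = real a) ∧ (∃ a, v i j = real a) ∧
        ∀ l, l ≠ i → expVal (α l) * expVal (v l j) < expVal (α i) * expVal (v i j) := by
  simp only [TropIndependent, TropDependent, IsGhostVector, not_exists, not_and, not_forall,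
    Finset.sum_apply, Pi.smul_apply, smul_eq_mul, sum_notMem_ghostPart_iff, mul_eq_real_iff,
    expVal_mul, and_assoc]

/-- Vectors that have, after scaling the coordinates, a unique maximum at a real entry, at pairwise
different coordinates, are independent. -/
theorem tropIndependent_of_dominant {ι : Type*} [Fintype ι] {n : ℕ} (v : ι → Fin n → ExtTrop)
    (p : ι → Fin n) (b : ι → ℝ) (hb : ∀ i, 0 < b i) (hreal : ∀ i, ∃ a, v i (p i) = real a)
    (hdom : ∀ i l, l ≠ i → b l * expVal (v i (p l)) < b i * expVal (v i (p i))) :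
    TropIndependent v := by
  refine (tropIndependent_iff v).2 fun α hα ⟨i₀, hi₀⟩ => ?_
  have : Nonempty ι := ⟨i₀⟩
  -- At the index with the largest scaled dominant term, that term wins its coordinate strictly.
  obtain ⟨i, hi⟩ := Finite.exists_max fun i => expVal (α i) * (b i * expVal (v i (p i)))
  have hv : ∀ i, 0 < expVal (v i (p i)) := fun i => by
    obtain ⟨a, ha⟩ := hreal i
    exact expVal_pos (by simp [ha])
  have hαi : 0 < expVal (α i) :=
    pos_of_mul_pos_left ((mul_pos (expVal_pos hi₀) (mul_pos (hb i₀) (hv i₀))).trans_le (hi i₀))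
      (mul_pos (hb i) (hv i)).le
  refine ⟨p i, i, ?_, hreal i, fun l hl => ?_⟩
  · exact (hα i).resolve_left fun h => by simp [h, expVal] at hαi
  rcases (expVal_nonneg (α l)).eq_or_lt with h0 | h0
  · rw [← h0, zero_mul]
    exact mul_pos hαi (hv i)
  · have h1 := (mul_lt_mul_of_pos_left (hdom l i hl.symm) h0).trans_le (hi l)
    refine lt_of_mul_lt_mul_left ?_ (hb i).le
    linarith

/-- If some rows are independent, then as many columns are independent. -/
theorem exists_independent_cols {m n : ℕ} (A : Matrix (Fin m) (Fin n) ExtTrop)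
    (s : Finset (Fin m)) (hs : TropIndependent fun i : s => A.row i) :
    ∃ t : Finset (Fin n), t.card = s.card ∧ TropIndependent fun j : t => A.col j := by
  classical
  rcases s.eq_empty_or_nonempty with rfl | hne
  · exact ⟨∅, rfl, fun ⟨_, _, ⟨i, _⟩, _⟩ => absurd i.2 (Finset.notMem_empty _)⟩
  have : Nonempty s := hne.to_subtype
  rw [tropIndependent_iff] at hs
  let J : s → Finset (Fin n) := fun i => Finset.univ.filter fun j => ∃ a, A i j = real a
  -- A row without real entries would be dependent by itself.
  have hJ : ∀ i, (J i).Nonempty := by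
    intro i
    obtain ⟨j, k, ⟨a, hk⟩, hA, -⟩ := hs (fun k => if k = i then real 0 else negInf)
      (fun k => by by_cases h : k = i <;> simp [h, realPart]) ⟨i, by simp⟩
    have hki : k = i := by by_contra h; simp [h] at hk
    exact ⟨j, by simpa [J, hki] using hA⟩
  -- The zero diagonal removes `l = i` from the maximum: it cannot bound a positive `x i`, and it
  -- costs nothing against `b i > 0`.
  let w : s → Fin n → s → ℝ := fun i j l => if l = i then 0 else expVal (A l j) / expVal (A i j)
  have hw : ∀ i j l, 0 ≤ w i j l := fun i j l => by
    by_cases h : l = i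
    · simp [w, h]
    · simpa [w, h] using div_nonneg (expVal_nonneg _) (expVal_nonneg _)
  rcases exists_subharmonic_or_strictly_superharmonic J hJ w hw with
    ⟨x, hx0, ⟨i₀, hi₀⟩, hx⟩ | ⟨b, hb, h⟩
  · exfalso
    let α : s → ExtTrop := fun i => if x i = 0 then negInf else real (Real.log (x i))
    have hα : ∀ i, expVal (α i) = x i := fun i => by
      by_cases h : x i = 0
      · simp [α, h, expVal]
      · simp [α, h, expVal, Real.exp_log ((hx0 i).lt_of_ne' h)]
    obtain ⟨j, i, ⟨a, hi⟩, hA, hlt⟩ := hs α (fun i => by by_cases h : x i = 0 <;> simp [α, h, realPart])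
      ⟨i₀, by simp [α, hi₀]⟩
    have hxi : 0 < x i := by rw [← hα, hi]; exact Real.exp_pos _
    have hAi : 0 < expVal (A i j) := by
      obtain ⟨a, ha⟩ := hA
      exact expVal_pos fun h => by simp_all
    obtain ⟨l, hl⟩ := hx i j (by simpa [J] using hA)
    by_cases hli : l = i
    · simp only [w, hli, if_true, zero_mul] at hl
      exact absurd hl (not_le.2 hxi)
    · have := hlt l hli
      simp only [hα] at this
      simp only [w, hli, if_false] at hl
      rw [div_mul_eq_mul_div, le_div_iff₀ hAi] at hl
      exact absurd this (not_lt.2 (by simpa [mul_comm] using hl))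
  · choose σ hσ hlt using h
    have hσ' : ∀ i : s, ∃ a, A i (σ i) = real a := fun i => by simpa [J] using hσ i
    have hpos : ∀ i : s, 0 < expVal (A i (σ i)) := fun i => by
      obtain ⟨a, ha⟩ := hσ' i
      exact expVal_pos fun h => by simp_all
    have hdom : ∀ i l : s, l ≠ i → b l * expVal (A l (σ i)) < b i * expVal (A i (σ i)) := by
      intro i l hl
      have := hlt i l
      simp only [w, hl, if_false] at this
      rw [div_mul_eq_mul_div, div_lt_iff₀ (hpos i)] at this
      linarith
    -- Two rows sharing a column would strictly dominate each other there.
    have hinj : Function.Injective σ := by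
      intro i l h
      by_contra hne
      have h1 := hdom i l (Ne.symm hne)
      have h2 := hdom l i hne
      rw [h] at h1
      exact lt_asymm h1 h2
    refine ⟨Finset.univ.image σ, by simp [Finset.card_image_of_injective _ hinj], ?_⟩
    have hmem : ∀ j : (Finset.univ.image σ : Finset (Fin n)), ∃ i, σ i = j := fun j => by
      simpa using j.2
    choose ρ hρ using hmem
    refine tropIndependent_of_dominant _ (fun j => (ρ j : Fin m)) (fun j => b (ρ j))
      (fun j => hb _) (fun j => ?_) fun j l hl => ?_
    · simpa [Matrix.col, hρ] using hσ' (ρ j)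
    · have := hdom (ρ j) (ρ l) fun h => hl (Subtype.ext (by rw [← hρ l, ← hρ j, h]))
      simpa [Matrix.col, hρ] using this

end ExtTrop

theorem mainTheorem7 (m n : ℕ) (A : Matrix (Fin m) (Fin n) ExtTrop) :
    IsGreatest {k : ℕ | ∃ s : Finset (Fin n), s.card = k ∧
      ExtTrop.TropIndependent fun j : s => A.col j} (ExtTrop.tropRank A) := by
  obtain ⟨⟨s, hs, h⟩, hmax⟩ := ExtTrop.isGreatest_tropRank A
  constructor
  · obtain ⟨t, ht, h'⟩ := ExtTrop.exists_independent_cols A s h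
    exact ⟨t, ht.trans hs, h'⟩
  · rintro k ⟨t, rfl, ht⟩
    obtain ⟨s, hs, h'⟩ := ExtTrop.exists_independent_cols A.transpose t ht
    exact hmax ⟨s, hs, h'⟩
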